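/- Let $H$ be an infinite-dimensional separable complex Hilbert space and let $B(H)$ be the algebra of bounded linear operators on $H$. For $T\in B(H)$ let $\sigma(T)$ be the spectrum, $\sigma_p(T)$ the set of eigenvalues, $N(T)$ the kernel, $R(T)$ the range, $n(T)=\dim N(T)$ and $d(T)=\dim H/R(T)$ (both in $\mathbb N\cup\{\infty\}$). Call $T$ upper semi-Fredholm if $n(T)<\infty$ and $R(T)$ is closed, lower semi-Fredholm if $d(T)<\infty$, and Fredholm if it is both; if $T$ is upper or lower semi-Fredholm, put $\mathrm{ind}\,T=n(T)-d(T)$. Call $T$ bounded below if it is upper semi-Fredholm with $n(T)=0$; Browder if it is Fredholm and there are $k,l\in\mathbb N$ with $N(T^k)=N(T^{k+1})$ and $R(T^l)=R(T^{l+1})$; and consistent in invertibility (CI) if, for every $S\in B(H)$, $ST$ is invertible if and only if $TS$ is invertible. Let $\sigma_a(T)$, $\sigma_b(T)$, $\sigma_{CI}(T)$ and $\sigma_{SF}(T)$ be the sets of $\lambda\in\mathbb C$ such that $T-\lambda I$ is, respectively, not bounded below, not Browder, not CI, and neither upper nor lower semi-Fredholm. Let $\sigma_{ea}(T)$ be the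 set of $\lambda\in\mathbb C$ such that $T-\lambda I$ is not upper semi-Fredholm or $\mathrm{ind}(T-\lambda I)>0$. For $E\subseteq\mathbb C$ let $\mathrm{iso}\,E$ and $\mathrm{acc}\,E$ be the sets of isolated points and of accumulation points of $E$. Say that $T$ satisfies property $(UW_E)$ if $$\sigma_a(T)\setminus\sigma_{ea}(T)=\mathrm{iso}\,\sigma(T)\cap\sigma_p(T).$$ Finally, let $\Pi^*(T)=\{\lambda\in\sigma(T): n(T-\lambda I)=n(T^*-\bar\lambda I)=0\}$, where $T^*$ is the Hilbert space adjoint of $T$. Theorem. For every $T\in B(H)$, both $T$ and $T^*$ satisfy property $(UW_E)$ if and only if $$\sigma_b(T)=\sigma_{CI}(T)\cup\Pi^*(T)\cup[\mathrm{acc}\,\sigma(T)\cap\sigma_{SF}(T)].$$ -/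

import Mathlib

open scoped ComplexConjugate

namespace PropertyUWE

noncomputable section

/-- `iso E`: the isolated points of `E ⊆ ℂ`. The accumulation points `acc E` are Mathlib's
`derivedSet E`. -/
def iso (E : Set ℂ) : Set ℂ := E \ derivedSet E

variable {H : Type*} [NormedAddCommGroup H] [InnerProductSpace ℂ H]

/-- `n(T)`: the dimension of the kernel of `T`, with value `⊤` if it is infinite. -/
def nullity (T : H →L[ℂ] H) : ℕ∞ :=
  Cardinal.toENat (Module.rank ℂ T.ker)

/-- `d(T)`: the (algebraic) codimension of the range of `T`, with value `⊤` if it is infinite. -/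
def defect (T : H →L[ℂ] H) : ℕ∞ :=
  Cardinal.toENat (Module.rank ℂ (H ⧸ T.range))

/-- `T ∈ Φ₊(H)`: `T` is upper semi-Fredholm. -/
def IsUpperSemiFredholm (T : H →L[ℂ] H) : Prop :=
  nullity T < ⊤ ∧ IsClosed (T.range : Set H)

/-- `T ∈ Φ₋(H)`: `T` is lower semi-Fredholm. (On a complete space, finite codimension of the range
of a bounded operator forces the range to be closed.) -/
def IsLowerSemiFredholm (T : H →L[ℂ] H) : Prop :=
  defect T < ⊤

/-- `T` is Fredholm: both upper and lower semi-Fredholm. -/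
def IsFredholm (T : H →L[ℂ] H) : Prop :=
  IsUpperSemiFredholm T ∧ IsLowerSemiFredholm T

/-- `ind T = n(T) - d(T)`, as an extended real number. It is used only for semi-Fredholm
operators, for which at most one of `n(T)` and `d(T)` is infinite. -/
def index (T : H →L[ℂ] H) : EReal :=
  ((nullity T : ENNReal) : EReal) - ((defect T : ENNReal) : EReal)

/-- `T` is bounded below: injective with closed range. -/
def IsBoundedBelow (T : H →L[ℂ] H) : Prop :=
  IsUpperSemiFredholm T ∧ nullity T = 0

/-- The ascent of `T` (the infimum of the empty set in `ℕ∞` being `⊤`). -/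
def ascent (T : H →L[ℂ] H) : ℕ∞ :=
  sInf {m : ℕ∞ | ∃ k : ℕ, m = k ∧ (T ^ k).ker = (T ^ (k + 1)).ker}

/-- The descent of `T` (the infimum of the empty set in `ℕ∞` being `⊤`). -/
def descent (T : H →L[ℂ] H) : ℕ∞ :=
  sInf {m : ℕ∞ | ∃ k : ℕ, m = k ∧ (T ^ k).range = (T ^ (k + 1)).range}

/-- `T` is Browder: Fredholm of finite ascent and descent. -/
def IsBrowder (T : H →L[ℂ] H) : Prop :=
  IsFredholm T ∧ ascent T < ⊤ ∧ descent T < ⊤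

/-- `T` is consistent in invertibility: for every bounded `S`, the operators `ST` and `TS` are
both invertible or both not invertible. -/
def IsCI (T : H →L[ℂ] H) : Prop :=
  ∀ S : H →L[ℂ] H, IsUnit (S * T) ↔ IsUnit (T * S)

/-- `T - λ I`. -/
def shift (T : H →L[ℂ] H) (z : ℂ) : H →L[ℂ] H :=
  T - z • ContinuousLinearMap.id ℂ H

/-- `σ_p(T)`: the eigenvalues of `T`. -/
def pointSpectrum (T : H →L[ℂ] H) : Set ℂ :=
  {z | Module.End.HasEigenvalue (T : H →ₗ[ℂ] H) z}

/-- `σ_a(T)`: the approximate point spectrum. -/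
def approxPointSpectrum (T : H →L[ℂ] H) : Set ℂ :=
  {z | ¬ IsBoundedBelow (shift T z)}

/-- `σ_ea(T)`: the essential approximate point spectrum. -/
def essApproxPointSpectrum (T : H →L[ℂ] H) : Set ℂ :=
  {z | ¬ IsUpperSemiFredholm (shift T z) ∨ 0 < index (shift T z)}

/-- `σ_SF₊(T)`: the upper semi-Fredholm spectrum. -/
def upperSemiFredholmSpectrum (T : H →L[ℂ] H) : Set ℂ :=
  {z | ¬ IsUpperSemiFredholm (shift T z)}

/-- `σ_SF₋(T)`: the lower semi-Fredholm spectrum. -/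
def lowerSemiFredholmSpectrum (T : H →L[ℂ] H) : Set ℂ :=
  {z | ¬ IsLowerSemiFredholm (shift T z)}

/-- `σ_SF(T)`: the semi-Fredholm spectrum. -/
def semiFredholmSpectrum (T : H →L[ℂ] H) : Set ℂ :=
  upperSemiFredholmSpectrum T ∩ lowerSemiFredholmSpectrum T

/-- `σ_b(T)`: the Browder spectrum. -/
def browderSpectrum (T : H →L[ℂ] H) : Set ℂ :=
  {z | ¬ IsBrowder (shift T z)}

/-- `σ_CI(T)`: the CI spectrum. -/
def ciSpectrum (T : H →L[ℂ] H) : Set ℂ :=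
  {z | ¬ IsCI (shift T z)}

/-- `E(T)`: the eigenvalues of `T` that are isolated points of the spectrum. -/
def isolatedEigenvalues (T : H →L[ℂ] H) : Set ℂ :=
  iso (spectrum ℂ T) ∩ pointSpectrum T

/-- `Π*(T)`: the points `z` of the spectrum such that `T - z I` and `T* - z̄ I` both have trivial
kernel. -/
def piStar [CompleteSpace H] (T : H →L[ℂ] H) : Set ℂ :=
  {z | z ∈ spectrum ℂ T ∧ nullity (shift T z) = 0 ∧
    nullity (shift (ContinuousLinearMap.adjoint T) (conj z)) = 0}

/-- Property `(UW_E)`. -/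
def HasPropertyUWE (T : H →L[ℂ] H) : Prop :=
  approxPointSpectrum T \ essApproxPointSpectrum T = isolatedEigenvalues T

end

end PropertyUWE

/-! Both sides are decided one point at a time. Fix z, put A = T - z, and let I say that A - w is
invertible for all small w ≠ 0, i.e. that z is not an accumulation point of σ(T).

Two facts link I to the Browder property. A Browder operator satisfies I and has n(A) = d(A)
(`IsBrowder.eventually_isUnit_shift`, `IsBrowder.nullity_eq_defect`); a semi-Fredholm operator
satisfying I is Browder (`isBrowder_of_frequently_isUnit_shift`). The second needs no stability of
the index: a generalized inverse exhibits A as a finite rank perturbation of the identity up to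
invertible factors, and finite ascent comes from the intersection of the ranges R(A^k).

Moreover A fails to be CI exactly when it is invertible from one side only (`not_isCI_iff`), and
d(A) = n(A*) when R(A) is closed. What remains is a case analysis on n(A), d(A) and I
(`propertyUWE_at_iff`). -/

namespace PropertyUWE

/-! ### Finite rank perturbations of the identity -/

section LinearAlgebra

variable {K V : Type*} [Field K] [AddCommGroup V] [Module K V]

/-- A finite rank perturbation of the identity has kernel and cokernel of the same finite
dimension. -/
theorem rank_ker_eq_rank_coker_id_add (F : V →ₗ[K] V) [FiniteDimensional K F.range] :
    Module.rank K (LinearMap.id + F).ker = Module.rank K (V ⧸ (LinearMap.id + F).range) ∧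
      Module.rank K (LinearMap.id + F).ker < Cardinal.aleph0 := by
  set G : V →ₗ[K] V := LinearMap.id + F with hG
  have hGx : ∀ x, G x = x + F x := fun x => rfl
  have hmem : ∀ x ∈ F.range, G x ∈ F.range := fun x hx => by
    rw [hGx]; exact add_mem hx ⟨x, rfl⟩
  have hmem' : ∀ x, G x ∈ F.range → x ∈ F.range := fun x hx => by
    have : x = G x - F x := by rw [hGx]; abel
    rw [this]; exact sub_mem hx ⟨x, rfl⟩
  -- Kernel and cokernel of 1 + F both live on the finite-dimensional space R(F), where rank-nullity
  -- makes them equal.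
  set g : F.range →ₗ[K] F.range := G.restrict hmem with hg
  have hker : g.ker = G.ker.comap F.range.subtype := by
    ext x
    simp [hg, LinearMap.restrict_apply, ← Subtype.coe_inj]
  have hle : G.ker ≤ F.range := fun x hx => hmem' x (by
    rw [LinearMap.mem_ker.1 hx]; exact zero_mem _)
  have e₁ : g.ker ≃ₗ[K] G.ker :=
    (LinearEquiv.ofEq _ _ hker).trans (Submodule.comapSubtypeEquivOfLe hle)
  let φ : F.range →ₗ[K] V ⧸ G.range := G.range.mkQ ∘ₗ F.range.subtype
  -- Modulo R(1 + F), every x is congruent to -F x.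
  have hφ : Function.Surjective φ := by
    intro y
    obtain ⟨x, rfl⟩ := Submodule.mkQ_surjective _ y
    refine ⟨⟨-F x, neg_mem ⟨x, rfl⟩⟩, ?_⟩
    refine (Submodule.Quotient.eq _).2 ⟨-x, ?_⟩
    simp only [Submodule.subtype_apply, map_neg, hGx]
    abel
  have hφk : φ.ker = g.range := by
    ext ⟨x, hx⟩
    simp only [φ, LinearMap.mem_ker, LinearMap.comp_apply, Submodule.mkQ_apply,
      Submodule.Quotient.mk_eq_zero, Submodule.subtype_apply, LinearMap.mem_range]
    constructor
    · rintro ⟨y, rfl⟩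
      exact ⟨⟨y, hmem' y hx⟩, rfl⟩
    · rintro ⟨y, hy⟩
      exact ⟨y, congrArg Subtype.val hy⟩
  have e₂ : (F.range ⧸ g.range) ≃ₗ[K] V ⧸ G.range :=
    (Submodule.quotEquivOfEq _ _ hφk.symm).trans (φ.quotKerEquivOfSurjective hφ)
  have h1 := g.finrank_range_add_finrank_ker
  have h2 := g.range.finrank_quotient_add_finrank
  rw [← e₁.rank_eq, ← e₂.rank_eq]
  refine ⟨?_, Module.rank_lt_aleph0 K _⟩
  rw [← Module.finrank_eq_rank, ← Module.finrank_eq_rank]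
  congr 1
  omega

theorem finiteDimensional_range_of_range_le_ker {W : Type*} [AddCommGroup W] [Module K W]
    (A : V →ₗ[K] V) (D : V →ₗ[K] W) [FiniteDimensional K (V ⧸ A.range)]
    (h : A.range ≤ D.ker) : FiniteDimensional K D.range := by
  have : D = A.range.liftQ D h ∘ₗ A.range.mkQ := (Submodule.liftQ_mkQ _ _ _).symm
  have h' : D.range = (A.range.liftQ D h).range := (Submodule.range_liftQ _ _ _).symm
  rw [h']
  infer_instance

end LinearAlgebra

/-! ### Shifts, nullity and defect -/

variable {H : Type*} [NormedAddCommGroup H] [InnerProductSpace ℂ H]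

theorem shift_apply (T : H →L[ℂ] H) (z : ℂ) (x : H) : shift T z x = T x - z • x := rfl

theorem shift_eq (T : H →L[ℂ] H) (z : ℂ) : shift T z = T - z • 1 := rfl

theorem shift_shift (T : H →L[ℂ] H) (z w : ℂ) : shift (shift T z) w = shift T (z + w) := by
  ext x; simp only [shift_apply, add_smul]; abel

theorem shift_zero (T : H →L[ℂ] H) : shift T 0 = T := by
  ext x; simp [shift_apply]

theorem nullity_eq_zero_iff {T : H →L[ℂ] H} : nullity T = 0 ↔ Function.Injective T := by
  rw [nullity, Cardinal.toENat_eq_zero, Submodule.rank_eq_zero, LinearMap.ker_eq_bot]; rfl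

theorem defect_eq_zero_iff {T : H →L[ℂ] H} : defect T = 0 ↔ Function.Surjective T := by
  rw [defect, Cardinal.toENat_eq_zero, rank_zero_iff, Submodule.Quotient.subsingleton_iff,
    LinearMap.range_eq_top]; rfl

theorem nullity_lt_top_iff {T : H →L[ℂ] H} : nullity T < ⊤ ↔ FiniteDimensional ℂ T.ker := by
  rw [nullity, Cardinal.toENat_lt_top, Module.rank_lt_aleph0_iff]

theorem defect_lt_top_iff {T : H →L[ℂ] H} :
    defect T < ⊤ ↔ FiniteDimensional ℂ (H ⧸ T.range) := by
  rw [defect, Cardinal.toENat_lt_top, Module.rank_lt_aleph0_iff]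

theorem nullity_mul_mul (U V : (H →L[ℂ] H)ˣ) (G : H →L[ℂ] H) :
    nullity (U * G * V : H →L[ℂ] H) = nullity G := by
  let v := (ContinuousLinearEquiv.ofUnit V).toLinearEquiv
  let u := (ContinuousLinearEquiv.ofUnit U).toLinearEquiv
  have hk : (U * G * V : H →L[ℂ] H).ker = G.ker.comap v.toLinearMap := by
    ext x
    exact u.map_eq_zero_iff (x := G (v x))
  rw [nullity, nullity, hk]
  congr 1
  exact (v.ofSubmodule' G.ker).rank_eq

theorem defect_mul_mul (U V : (H →L[ℂ] H)ˣ) (G : H →L[ℂ] H) :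
    defect (U * G * V : H →L[ℂ] H) = defect G := by
  let v := (ContinuousLinearEquiv.ofUnit V).toLinearEquiv
  let u := (ContinuousLinearEquiv.ofUnit U).toLinearEquiv
  have hk : G.range.map u.toLinearMap = (U * G * V : H →L[ℂ] H).range := by
    ext x
    constructor
    · rintro ⟨_, ⟨y, rfl⟩, rfl⟩
      obtain ⟨w, rfl⟩ := v.surjective y
      exact ⟨w, rfl⟩
    · rintro ⟨y, rfl⟩
      exact ⟨G (v y), ⟨v y, rfl⟩, rfl⟩
  rw [defect, defect]
  congr 1
  exact (Submodule.Quotient.equiv _ _ u hk).rank_eq.symm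

theorem nullity_eq_defect_one_add (F : H →L[ℂ] H) (hF : FiniteDimensional ℂ F.range) :
    nullity (1 + F) = defect (1 + F) ∧ nullity (1 + F) < ⊤ := by
  have := rank_ker_eq_rank_coker_id_add (F : H →ₗ[ℂ] H)
  refine ⟨congrArg Cardinal.toENat this.1, ?_⟩
  rw [nullity, Cardinal.toENat_lt_top]
  exact this.2

/-- The restriction of an operator to the orthogonal complement of its kernel. -/
noncomputable def injectivePart (A : H →L[ℂ] H) : A.kerᗮ →L[ℂ] H := A ∘L A.kerᗮ.subtypeL

theorem injectivePart_injective (A : H →L[ℂ] H) : Function.Injective (injectivePart A) := by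
  rw [injective_iff_map_eq_zero]
  rintro ⟨x, hx⟩ h
  have h1 : x ∈ A.ker := h
  exact Subtype.ext (inner_self_eq_zero.1 ((Submodule.mem_orthogonal _ _).1 hx x h1))

/-- AB is a bounded idempotent with range R(A), so R(A) is its fixed-point set. -/
theorem isClosed_range_of_mul_mul_eq_self {A B : H →L[ℂ] H} (h : A * B * A = A) :
    IsClosed (A.range : Set H) := by
  have : (A.range : Set H) = {y | A (B y) = y} := by
    ext y
    constructor
    · rintro ⟨x, rfl⟩
      exact DFunLike.congr_fun h x
    · intro hy
      exact ⟨B y, hy⟩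
  rw [this]
  exact isClosed_eq (by fun_prop) continuous_id

/-! ### Generalized inverses, closed ranges and duality -/

section Complete

variable [CompleteSpace H]

theorem injectivePart_orthogonalProjectionOnto (A : H →L[ℂ] H) (x : H) :
    injectivePart A (A.kerᗮ.orthogonalProjectionOnto x) = A x := by
  have hc : CompleteSpace A.ker := A.isClosed_ker.completeSpace_coe
  have h1 := A.kerᗮ.sub_starProjection_mem_orthogonal x
  rw [Submodule.orthogonal_orthogonal A.ker] at h1
  have h2 : A (x - A.kerᗮ.orthogonalProjectionOnto x) = 0 := h1
  rw [map_sub, sub_eq_zero] at h2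
  exact h2.symm

theorem range_injectivePart (A : H →L[ℂ] H) : (injectivePart A).range = A.range := by
  ext y
  constructor
  · rintro ⟨x, rfl⟩
    exact ⟨x, rfl⟩
  · rintro ⟨x, rfl⟩
    exact ⟨A.kerᗮ.orthogonalProjectionOnto x, injectivePart_orthogonalProjectionOnto A x⟩

/-- An operator with closed range on a Hilbert space has a bounded generalized inverse. -/
theorem exists_mul_mul_eq_self {A : H →L[ℂ] H} (hA : IsClosed (A.range : Set H)) :
    ∃ B : H →L[ℂ] H, A * B * A = A := by
  let f := injectivePart A
  have hcl : IsClosed (f.range : Set H) := by rwa [range_injectivePart]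
  have : CompleteSpace f.range := hcl.completeSpace_coe
  let e := f.equivRange (injectivePart_injective A) hcl
  refine ⟨A.kerᗮ.subtypeL ∘L (e.symm : f.range →L[ℂ] A.kerᗮ) ∘L
    f.range.orthogonalProjectionOnto, ?_⟩
  ext x
  let y : A.kerᗮ := A.kerᗮ.orthogonalProjectionOnto x
  have h1 : A x = (⟨f y, ⟨y, rfl⟩⟩ : f.range) :=
    (injectivePart_orthogonalProjectionOnto A x).symm
  have h2 : f.range.orthogonalProjectionOnto (A x) = ⟨f y, ⟨y, rfl⟩⟩ := by
    rw [h1]; exact Submodule.orthogonalProjectionOnto_mem_subspace_eq_self _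
  have h3 : e.symm ⟨f y, ⟨y, rfl⟩⟩ = y := ContinuousLinearMap.equivRange_symm_apply _ _ y
  change A (e.symm (f.range.orthogonalProjectionOnto (A x))) = A x
  rw [h2, h3]
  exact injectivePart_orthogonalProjectionOnto A x

/-- An algebraic complement of R(A) is finite-dimensional, hence closed; an injective operator whose
range has a closed complement has closed range. -/
theorem IsLowerSemiFredholm.isClosed_range {A : H →L[ℂ] H} (hA : IsLowerSemiFredholm A) :
    IsClosed (A.range : Set H) := by
  have := defect_lt_top_iff.1 hA
  obtain ⟨G, hG⟩ := Submodule.exists_isCompl A.range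
  have : FiniteDimensional ℂ G :=
    (Submodule.quotientEquivOfIsCompl _ _ hG).finiteDimensional
  rw [← range_injectivePart] at hG ⊢
  exact (injectivePart A).closed_complemented_range_of_isCompl_of_ker_eq_bot G hG
    G.closed_of_finiteDimensional (LinearMap.ker_eq_bot.2 (injectivePart_injective A))

theorem isClosed_range_adjoint {A : H →L[ℂ] H} (hA : IsClosed (A.range : Set H)) :
    IsClosed ((ContinuousLinearMap.adjoint A).range : Set H) := by
  obtain ⟨B, hB⟩ := exists_mul_mul_eq_self hA
  refine isClosed_range_of_mul_mul_eq_self (B := star B) ?_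
  rw [← ContinuousLinearMap.star_eq_adjoint, mul_assoc, ← star_mul, ← star_mul, hB]

theorem defect_eq_nullity_adjoint {A : H →L[ℂ] H} (hA : IsClosed (A.range : Set H)) :
    defect A = nullity (ContinuousLinearMap.adjoint A) := by
  have : CompleteSpace A.range := hA.completeSpace_coe
  rw [defect, nullity, ← ContinuousLinearMap.orthogonal_range]
  exact congrArg _ (Submodule.quotientEquivOfIsCompl _ _
    A.range.isCompl_orthogonal).rank_eq

theorem nullity_eq_defect_adjoint {A : H →L[ℂ] H} (hA : IsClosed (A.range : Set H)) :
    nullity A = defect (ContinuousLinearMap.adjoint A) := by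
  rw [defect_eq_nullity_adjoint (isClosed_range_adjoint hA), ContinuousLinearMap.adjoint_adjoint]

/-- With U = 1 - wB and C = A - w both invertible, UA = C + w(1 - BA) and AU = C + w(1 - AB). Since
1 - BA maps into N(A) and 1 - AB kills R(A), one of them has finite rank, and A is 1 + F up to
invertible factors. -/
theorem nullity_eq_defect_of_isUnit_shift {A B : H →L[ℂ] H} (hAB : A * B * A = A) {w : ℂ}
    (hw : ‖w • B‖ < 1) (hu : IsUnit (shift A w)) (hfin : nullity A < ⊤ ∨ defect A < ⊤) :
    nullity A = defect A ∧ nullity A < ⊤ := by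
  obtain ⟨U, hU⟩ := isUnit_one_sub_of_norm_lt_one hw
  obtain ⟨C, hC⟩ := hu
  have hC' : A = C + w • 1 := by rw [hC, shift_eq]; abel
  rcases hfin with hn | hd
  · have hn' := nullity_lt_top_iff.1 hn
    let F : H →L[ℂ] H := (w • ↑C⁻¹) * (1 - B * A)
    have hle : (1 - B * A).range ≤ A.ker := by
      rintro _ ⟨x, rfl⟩
      have := DFunLike.congr_fun hAB x
      change A (x - B (A x)) = 0
      rw [map_sub, sub_eq_zero]
      exact this.symm
    have hF : FiniteDimensional ℂ F.range := by
      have h1 := Submodule.finiteDimensional_of_le hle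
      have : F.range = (1 - B * A).range.map ((w • ↑C⁻¹ : H →L[ℂ] H) : H →ₗ[ℂ] H) :=
        LinearMap.range_comp _ _
      rw [this]
      infer_instance
    have hA : A = ↑(U⁻¹ * C) * (1 + F) * ↑(1 : (H →L[ℂ] H)ˣ) := by
      have h1 : (C : H →L[ℂ] H) * (1 + F) = U * A := by
        simp only [F, mul_add, smul_mul_assoc, mul_smul_comm, Units.mul_inv_cancel_left, mul_one]
        rw [hU, hC, shift_eq, sub_mul, one_mul, smul_mul_assoc, smul_sub]
        abel
      rw [Units.val_mul, mul_assoc (↑U⁻¹ : H →L[ℂ] H), h1, Units.inv_mul_cancel_left, Units.val_one,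
        mul_one]
    rw [hA, nullity_mul_mul, defect_mul_mul]
    exact nullity_eq_defect_one_add F hF
  · have hd' := defect_lt_top_iff.1 hd
    let F : H →L[ℂ] H := (w • ↑C⁻¹) * (1 - A * B)
    have hle : A.range ≤ F.ker := by
      rintro _ ⟨x, rfl⟩
      have h1 : F * A = 0 := by
        simp only [F, mul_assoc, sub_mul, one_mul]
        rw [← mul_assoc A, hAB, sub_self, mul_zero]
      exact DFunLike.congr_fun h1 x
    have hF : FiniteDimensional ℂ F.range :=
      finiteDimensional_range_of_range_le_ker (A : H →ₗ[ℂ] H) (F : H →ₗ[ℂ] H) hle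
    have hA : A = ↑C * (1 + F) * ↑U⁻¹ := by
      have h1 : (C : H →L[ℂ] H) * (1 + F) = A * U := by
        simp only [F, mul_add, smul_mul_assoc, mul_smul_comm, Units.mul_inv_cancel_left, mul_one]
        rw [hU, hC, shift_eq, mul_sub, mul_one, mul_smul_comm, smul_sub]
        abel
      rw [h1, Units.mul_inv_cancel_right]
    rw [hA, nullity_mul_mul, defect_mul_mul]
    exact nullity_eq_defect_one_add F hF

end Complete

/-! ### Ascent, descent and invertibility of small shifts -/

open Filter Topology

theorem ascent_lt_top_iff {T : H →L[ℂ] H} :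
    ascent T < ⊤ ↔ ∃ k : ℕ, (T ^ k).ker = (T ^ (k + 1)).ker := by
  rw [ascent, sInf_lt_iff]
  constructor
  · rintro ⟨_, ⟨k, -, hk⟩, -⟩
    exact ⟨k, hk⟩
  · rintro ⟨k, hk⟩
    exact ⟨k, ⟨k, rfl, hk⟩, ENat.natCast_lt_top k⟩

theorem descent_lt_top_iff {T : H →L[ℂ] H} :
    descent T < ⊤ ↔ ∃ k : ℕ, (T ^ k).range = (T ^ (k + 1)).range := by
  rw [descent, sInf_lt_iff]
  constructor
  · rintro ⟨_, ⟨k, -, hk⟩, -⟩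
    exact ⟨k, hk⟩
  · rintro ⟨k, hk⟩
    exact ⟨k, ⟨k, rfl, hk⟩, ENat.natCast_lt_top k⟩

theorem range_pow_succ (T : H →L[ℂ] H) (k : ℕ) :
    (T ^ (k + 1)).range = (T ^ k).range.map (T : H →ₗ[ℂ] H) := by
  rw [pow_succ']
  exact LinearMap.range_comp _ _

theorem ker_pow_succ (T : H →L[ℂ] H) (k : ℕ) :
    (T ^ (k + 1)).ker = (T ^ k).ker.comap (T : H →ₗ[ℂ] H) := by
  rw [pow_succ]
  exact LinearMap.ker_comp _ _

theorem range_pow_antitone (T : H →L[ℂ] H) : Antitone fun k => (T ^ k).range := by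
  refine antitone_nat_of_succ_le fun k => ?_
  rw [pow_succ]
  rintro _ ⟨x, rfl⟩
  exact ⟨T x, rfl⟩

theorem range_pow_eq {T : H →L[ℂ] H} {k m : ℕ} (h : (T ^ k).range = (T ^ (k + 1)).range)
    (hkm : k ≤ m) : (T ^ m).range = (T ^ k).range := by
  induction m, hkm using Nat.le_induction with
  | base => rfl
  | succ m _ ih => rw [range_pow_succ, ih, ← range_pow_succ, h]

theorem ker_pow_eq {T : H →L[ℂ] H} {k m : ℕ} (h : (T ^ k).ker = (T ^ (k + 1)).ker)
    (hkm : k ≤ m) : (T ^ m).ker = (T ^ k).ker := by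
  induction m, hkm using Nat.le_induction with
  | base => rfl
  | succ m _ ih => rw [ker_pow_succ, ih, ← ker_pow_succ, h]

/-- The operator induced on an invariant subspace. -/
def restrictInvariant (A : H →L[ℂ] H) (M : Submodule ℂ H) (h : ∀ x ∈ M, A x ∈ M) : M →L[ℂ] M :=
  (A ∘L M.subtypeL).codRestrict M fun x => h x x.2

theorem eventually_norm_smul_lt_one (B : H →L[ℂ] H) : ∀ᶠ w in 𝓝[≠] (0 : ℂ), ‖w • B‖ < 1 := by
  have h : Continuous fun w : ℂ => ‖w • B‖ := by fun_prop
  exact (h.tendsto 0).mono_left nhdsWithin_le_nhds |>.eventually_lt_const (by simp)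

section Complete

variable [CompleteSpace H]

theorem eventually_isUnit_shift_of_isUnit {A : H →L[ℂ] H} (hA : IsUnit A) :
    ∀ᶠ w in 𝓝[≠] (0 : ℂ), IsUnit (shift A w) := by
  have hcont : Continuous fun w : ℂ => shift A w := by
    simp only [shift_eq]; fun_prop
  refine nhdsWithin_le_nhds (hcont.continuousAt.preimage_mem_nhds (Units.isOpen.mem_nhds ?_))
  change IsUnit _
  rwa [shift_zero]

/-- A right inverse B gives A - w = A(1 - wB), with 1 - wB invertible for small w. The next lemma is
the mirror image, with a left inverse. -/
theorem injective_of_frequently_injective_shift {A : H →L[ℂ] H} (hs : Function.Surjective A)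
    (h : ∃ᶠ w in 𝓝[≠] (0 : ℂ), Function.Injective (shift A w)) : Function.Injective A := by
  have hr : IsClosed (A.range : Set H) := by
    rw [LinearMap.range_eq_top.2 hs]; exact isClosed_univ
  obtain ⟨B, hB⟩ := exists_mul_mul_eq_self hr
  obtain ⟨w, hw, hwB⟩ := (h.and_eventually (eventually_norm_smul_lt_one B)).exists
  have hAB : A * B = 1 := by
    ext y
    obtain ⟨x, rfl⟩ := hs y
    exact DFunLike.congr_fun hB x
  have hU := ContinuousLinearMap.isUnit_iff_bijective.1 (isUnit_one_sub_of_norm_lt_one hwB)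
  have hfac : A * (1 - w • B) = shift A w := by
    rw [mul_sub, mul_one, mul_smul_comm, hAB, shift_eq]
  rw [← hfac] at hw
  exact Function.Injective.of_comp_right (f := A) hw hU.2

theorem surjective_of_frequently_surjective_shift {A : H →L[ℂ] H} (hi : Function.Injective A)
    (hr : IsClosed (A.range : Set H))
    (h : ∃ᶠ w in 𝓝[≠] (0 : ℂ), Function.Surjective (shift A w)) : Function.Surjective A := by
  obtain ⟨B, hB⟩ := exists_mul_mul_eq_self hr
  obtain ⟨w, hw, hwB⟩ := (h.and_eventually (eventually_norm_smul_lt_one B)).exists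
  have hBA : B * A = 1 := by
    ext x
    exact hi (DFunLike.congr_fun hB x)
  have hU := ContinuousLinearMap.isUnit_iff_bijective.1 (isUnit_one_sub_of_norm_lt_one hwB)
  have hfac : (1 - w • B) * A = shift A w := by
    rw [sub_mul, one_mul, smul_mul_assoc, hBA, shift_eq]
  rw [← hfac] at hw
  exact Function.Surjective.of_comp_left (f := (1 - w • B : H →L[ℂ] H)) (g := A) hw hU.1

/-- With ABA = A, the image A(V) consists of the y such that ABy = y and By ∈ V + N(A); this sum is
closed because N(A) is finite-dimensional. -/
theorem IsUpperSemiFredholm.isClosed_map {A : H →L[ℂ] H} (hA : IsUpperSemiFredholm A)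
    {V : Submodule ℂ H} (hV : IsClosed (V : Set H)) :
    IsClosed (V.map (A : H →ₗ[ℂ] H) : Set H) := by
  obtain ⟨B, hB⟩ := exists_mul_mul_eq_self hA.2
  have := nullity_lt_top_iff.1 hA.1
  have hsup := V.isClosed_sup_finiteDimensional A.ker hV
  have : (V.map (A : H →ₗ[ℂ] H) : Set H) =
      {y | A (B y) = y} ∩ B ⁻¹' (V ⊔ A.ker : Submodule ℂ H) := by
    ext y
    constructor
    · rintro ⟨x, hx, rfl⟩
      have h1 : A (B (A x)) = A x := DFunLike.congr_fun hB x
      refine ⟨h1, ?_⟩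
      have h2 : B (A x) = x + (B (A x) - x) := by abel
      change B (A x) ∈ V ⊔ A.ker
      rw [h2]
      refine Submodule.add_mem_sup hx ?_
      change A (B (A x) - x) = 0
      rw [map_sub, h1, sub_self]
    · rintro ⟨h1, h2⟩
      obtain ⟨v, hv, n, hn, hvn⟩ := Submodule.mem_sup.1 h2
      refine ⟨v, hv, ?_⟩
      have hn' : A n = 0 := hn
      change A v = y
      rw [← h1, ← hvn, map_add, hn', add_zero]
  rw [this]
  exact (isClosed_eq (by fun_prop) continuous_id).inter (hsup.preimage B.continuous)

theorem IsUpperSemiFredholm.isClosed_range_pow {A : H →L[ℂ] H} (hA : IsUpperSemiFredholm A)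
    (k : ℕ) : IsClosed ((A ^ k).range : Set H) := by
  induction k with
  | zero =>
    have : (A ^ 0).range = ⊤ := LinearMap.range_eq_top.2 fun x => ⟨x, rfl⟩
    rw [this]; exact isClosed_univ
  | succ k ih => rw [range_pow_succ]; exact hA.isClosed_map ih

/-- A maps M = ⋂ R(A^k) onto itself, and injectivity of nearby shifts passes to M, so A is injective
on M. The chain N(A) ∩ R(A^k) stabilizes at some N, so N(A) ∩ R(A^N) lies in M and is therefore
zero. -/
theorem IsUpperSemiFredholm.ascent_lt_top {A : H →L[ℂ] H} (hA : IsUpperSemiFredholm A)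
    (h : ∃ᶠ w in 𝓝[≠] (0 : ℂ), Function.Injective (shift A w)) : ascent A < ⊤ := by
  have := nullity_lt_top_iff.1 hA.1
  let f : ℕ →o (Submodule ℂ A.ker)ᵒᵈ :=
    ⟨fun k => OrderDual.toDual ((A ^ k).range.comap A.ker.subtype),
      fun i j hij => Submodule.comap_mono (range_pow_antitone A hij)⟩
  obtain ⟨N, hN⟩ := IsArtinian.monotone_stabilizes f
  have hstab : ∀ x, A x = 0 → x ∈ (A ^ N).range → ∀ k, x ∈ (A ^ k).range := by
    intro x hx hxN k
    rcases le_total k N with hk | hk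
    · exact range_pow_antitone A hk hxN
    · have h1 : (A ^ N).range.comap A.ker.subtype = (A ^ k).range.comap A.ker.subtype := hN k hk
      have h2 : (⟨x, hx⟩ : A.ker) ∈ (A ^ N).range.comap A.ker.subtype := hxN
      rw [h1] at h2
      exact h2
  let M : Submodule ℂ H := ⨅ k, (A ^ k).range
  have hMmem : ∀ x, x ∈ M ↔ ∀ k, x ∈ (A ^ k).range := fun x => Submodule.mem_iInf _
  have hMcl : IsClosed (M : Set H) := by
    rw [Submodule.coe_iInf]
    exact isClosed_iInter fun k => hA.isClosed_range_pow k
  have hM : ∀ x ∈ M, A x ∈ M := by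
    intro x hx
    rw [hMmem] at hx ⊢
    intro k
    have : A x ∈ (A ^ (k + 1)).range := by
      rw [range_pow_succ]; exact ⟨x, hx k, rfl⟩
    exact range_pow_antitone A k.le_succ this
  have : CompleteSpace M := hMcl.completeSpace_coe
  have hsurj : Function.Surjective (restrictInvariant A M hM) := by
    rintro ⟨y, hy⟩
    rw [hMmem] at hy
    have hex : ∀ k, ∃ x ∈ (A ^ k).range, A x = y := fun k => by
      have := hy (k + 1)
      rw [range_pow_succ] at this
      exact this
    obtain ⟨x, hxN, hx⟩ := hex N
    -- One preimage x in R(A^N) serves every k: it differs from a preimage in R(A^k) by an element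
    -- of N(A) ∩ R(A^N), which lies in all the ranges.
    refine ⟨⟨x, (hMmem x).2 fun k => ?_⟩, Subtype.ext hx⟩
    rcases le_total k N with hk | hk
    · exact range_pow_antitone A hk hxN
    · obtain ⟨z, hzk, hz⟩ := hex k
      have h1 := hstab (x - z) (by rw [map_sub, hx, hz, sub_self])
        (sub_mem hxN (range_pow_antitone A hk hzk)) k
      simpa using add_mem h1 hzk
  have hinj : Function.Injective (restrictInvariant A M hM) := by
    refine injective_of_frequently_injective_shift hsurj (h.mono fun w hw x y hxy => ?_)
    exact Subtype.ext (hw (congrArg Subtype.val hxy))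
  refine ascent_lt_top_iff.2 ⟨N, le_antisymm (fun x hx => ?_) fun x hx => ?_⟩
  · rw [pow_succ']
    change A ((A ^ N) x) = 0
    have : (A ^ N) x = 0 := hx
    rw [this, map_zero]
  · rw [pow_succ'] at hx
    have hx' : A ((A ^ N) x) = 0 := hx
    have hmem : (A ^ N) x ∈ M := (hMmem _).2 (hstab _ hx' ⟨x, rfl⟩)
    have h0 : restrictInvariant A M hM ⟨(A ^ N) x, hmem⟩ = restrictInvariant A M hM 0 := by
      rw [map_zero]; exact Subtype.ext hx'
    exact congrArg Subtype.val (hinj h0)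

theorem shift_adjoint (T : H →L[ℂ] H) (z : ℂ) :
    shift (ContinuousLinearMap.adjoint T) (conj z) = ContinuousLinearMap.adjoint (shift T z) := by
  rw [shift_eq, shift_eq, ← ContinuousLinearMap.star_eq_adjoint,
    ← ContinuousLinearMap.star_eq_adjoint, star_sub, star_smul, star_one]
  rfl

theorem isUnit_adjoint_iff {T : H →L[ℂ] H} :
    IsUnit (ContinuousLinearMap.adjoint T) ↔ IsUnit T := by
  rw [← ContinuousLinearMap.star_eq_adjoint, isUnit_star]

theorem tendsto_conj_nhdsNE_zero : Tendsto (fun w : ℂ => conj w) (𝓝[≠] 0) (𝓝[≠] 0) := by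
  refine tendsto_nhdsWithin_iff.2 ⟨?_, ?_⟩
  · have : Tendsto (fun w : ℂ => conj w) (𝓝 0) (𝓝 (conj 0)) := Complex.continuous_conj.tendsto 0
    rw [map_zero] at this
    exact this.mono_left nhdsWithin_le_nhds
  · filter_upwards [self_mem_nhdsWithin] with w hw
    exact (map_ne_zero _).2 hw

theorem frequently_isUnit_shift_adjoint {A : H →L[ℂ] H}
    (h : ∃ᶠ w in 𝓝[≠] (0 : ℂ), IsUnit (shift A w)) :
    ∃ᶠ w in 𝓝[≠] (0 : ℂ), IsUnit (shift (ContinuousLinearMap.adjoint A) w) := by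
  refine tendsto_conj_nhdsNE_zero.frequently (h.mono fun w hw => ?_)
  rwa [shift_adjoint, isUnit_adjoint_iff]

/-- A semi-Fredholm operator which is a limit of invertible operators `A - w` with `w ≠ 0` is
Browder. -/
theorem isBrowder_of_frequently_isUnit_shift {A : H →L[ℂ] H}
    (hA : IsUpperSemiFredholm A ∨ IsLowerSemiFredholm A)
    (h : ∃ᶠ w in 𝓝[≠] (0 : ℂ), IsUnit (shift A w)) :
    IsBrowder A ∧ nullity A = defect A := by
  have hr : IsClosed (A.range : Set H) := hA.elim (fun h => h.2) fun h => h.isClosed_range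
  obtain ⟨B, hB⟩ := exists_mul_mul_eq_self hr
  obtain ⟨w, hw, hwB⟩ := (h.and_eventually (eventually_norm_smul_lt_one B)).exists
  obtain ⟨heq, hlt⟩ := nullity_eq_defect_of_isUnit_shift hB hwB hw (hA.imp_left fun h => h.1)
  have hu : IsUpperSemiFredholm A := ⟨hlt, hr⟩
  have hl : IsLowerSemiFredholm A := heq.symm.trans_lt hlt
  have hu' : IsUpperSemiFredholm (ContinuousLinearMap.adjoint A) :=
    ⟨defect_eq_nullity_adjoint hr ▸ hl, isClosed_range_adjoint hr⟩
  refine ⟨⟨⟨hu, hl⟩, hu.ascent_lt_top (h.mono fun w hw =>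
    (ContinuousLinearMap.isUnit_iff_bijective.1 hw).1), ?_⟩, heq⟩
  -- Finite descent is finite ascent of the adjoint: N((A*)^k) is the orthogonal complement of
  -- R(A^k), and these ranges are closed.
  obtain ⟨k, hk⟩ := ascent_lt_top_iff.1 (hu'.ascent_lt_top
    ((frequently_isUnit_shift_adjoint h).mono fun w hw =>
      (ContinuousLinearMap.isUnit_iff_bijective.1 hw).1))
  rw [← ContinuousLinearMap.star_eq_adjoint, ← star_pow, ← star_pow,
    ContinuousLinearMap.star_eq_adjoint, ContinuousLinearMap.star_eq_adjoint,
    ← ContinuousLinearMap.orthogonal_range, ← ContinuousLinearMap.orthogonal_range] at hk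
  have h1 : CompleteSpace (A ^ k).range := (hu.isClosed_range_pow k).completeSpace_coe
  have h2 : CompleteSpace (A ^ (k + 1)).range := (hu.isClosed_range_pow (k + 1)).completeSpace_coe
  refine descent_lt_top_iff.2 ⟨k, ?_⟩
  rw [← (A ^ k).range.orthogonal_orthogonal, hk, Submodule.orthogonal_orthogonal]

/-- A Browder operator is invertible or `0` is isolated in its spectrum. -/
theorem IsBrowder.eventually_isUnit_shift {A : H →L[ℂ] H} (hA : IsBrowder A) :
    ∀ᶠ w in 𝓝[≠] (0 : ℂ), IsUnit (shift A w) := by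
  obtain ⟨⟨hu, -⟩, ha, hd⟩ := hA
  obtain ⟨k, hk⟩ := ascent_lt_top_iff.1 ha
  obtain ⟨l, hl⟩ := descent_lt_top_iff.1 hd
  obtain ⟨p, hkp, hlp⟩ : ∃ p, k ≤ p ∧ l ≤ p := ⟨max k l, le_max_left _ _, le_max_right _ _⟩
  have hker : (A ^ (p + 1)).ker = (A ^ p).ker := by
    rw [ker_pow_eq hk hkp, ker_pow_eq hk (hkp.trans p.le_succ)]
  have hran : ∀ m, p ≤ m → (A ^ m).range = (A ^ p).range := fun m hm => by
    rw [range_pow_eq hl hlp, range_pow_eq hl (hlp.trans hm)]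
  set M := (A ^ p).range with hMdef
  have hMmap : M.map (A : H →ₗ[ℂ] H) = M := by rw [← range_pow_succ, hran _ p.le_succ]
  have hM : ∀ x ∈ M, A x ∈ M := fun x hx => hMmap ▸ ⟨x, hx, rfl⟩
  have : CompleteSpace M := (hu.isClosed_range_pow p).completeSpace_coe
  -- Beyond both ascent and descent, A is bijective on M = R(A^p), so its small shifts are
  -- invertible there.
  have hunit : IsUnit (restrictInvariant A M hM) := by
    refine ContinuousLinearMap.isUnit_iff_bijective.2
      ⟨(injective_iff_map_eq_zero _).2 ?_, ?_⟩
    · rintro ⟨_, x, rfl⟩ h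
      have h1 : A ((A ^ p) x) = 0 := congrArg Subtype.val h
      have h2 : x ∈ (A ^ (p + 1)).ker := by rw [pow_succ']; exact h1
      rw [hker] at h2
      exact Subtype.ext h2
    · rintro ⟨y, hy⟩
      rw [← hMmap] at hy
      obtain ⟨x, hx, hxy⟩ := hy
      exact ⟨⟨x, hx⟩, Subtype.ext hxy⟩
  have hev := eventually_isUnit_shift_of_isUnit hunit
  filter_upwards [hev, self_mem_nhdsWithin] with w hw hw0
  have hw0' : w ≠ 0 := hw0
  have hbij := ContinuousLinearMap.isUnit_iff_bijective.1 hw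
  -- A - w divides A^p - w^p on either side. This puts N(A - w) inside M and inverts A - w on
  -- N(A^p), where A^p - w^p acts as -w^p.
  obtain ⟨Q, hQ⟩ : ∃ Q, A ^ p - (w • 1 : H →L[ℂ] H) ^ p = shift A w * Q :=
    ((Commute.one_right A).smul_right w).sub_dvd_pow_sub_pow p
  have hwp : ∀ x, ((w • 1 : H →L[ℂ] H) ^ p) x = w ^ p • x := by
    intro x; rw [smul_pow, one_pow]; rfl
  have hQx : ∀ x, (A ^ p) x - w ^ p • x = shift A w (Q x) := fun x => by
    rw [← hwp]; exact DFunLike.congr_fun hQ x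
  obtain ⟨Q', hQ'⟩ : ∃ Q', A ^ p - (w • 1 : H →L[ℂ] H) ^ p = Q' * shift A w :=
    ⟨_, (((Commute.one_right A).smul_right w).geom_sum₂_mul p).symm⟩
  refine ContinuousLinearMap.isUnit_iff_bijective.2 ⟨(injective_iff_map_eq_zero _).2 ?_, ?_⟩
  · intro x hx
    have h1 : (A ^ p) x - w ^ p • x = 0 := by
      rw [← hwp]
      refine (DFunLike.congr_fun hQ' x).trans ?_
      change Q' (shift A w x) = 0
      rw [hx, map_zero]
    have h2 : x ∈ M := ⟨(w ^ p)⁻¹ • x, by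
      change (A ^ p) ((w ^ p)⁻¹ • x) = x
      rw [map_smul, sub_eq_zero.1 h1, inv_smul_smul₀ (pow_ne_zero p hw0')]⟩
    have h3 : shift (restrictInvariant A M hM) w ⟨x, h2⟩ =
        shift (restrictInvariant A M hM) w 0 := by
      rw [map_zero]; exact Subtype.ext hx
    exact congrArg Subtype.val (hbij.1 h3)
  · intro y
    -- Split y = A^p z + (y - A^p z), with the first term in M and the second in N(A^p).
    obtain ⟨z, hz⟩ : (A ^ p) y ∈ (A ^ (p + p)).range := by
      rw [hran _ (Nat.le_add_left p p)]; exact ⟨y, rfl⟩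
    rw [pow_add] at hz
    have hz' : (A ^ p) ((A ^ p) z) = (A ^ p) y := hz
    obtain ⟨⟨m, hm⟩, hmz⟩ := hbij.2 ⟨(A ^ p) z, ⟨z, rfl⟩⟩
    have hmz' : shift A w m = (A ^ p) z := congrArg Subtype.val hmz
    have hu0 := hQx (y - (A ^ p) z)
    rw [map_sub, hz', sub_self, zero_sub] at hu0
    refine ⟨m - (w ^ p)⁻¹ • Q (y - (A ^ p) z), ?_⟩
    rw [map_sub, map_smul, ← hu0, hmz', smul_neg, inv_smul_smul₀ (pow_ne_zero p hw0')]
    abel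

end Complete

/-! ### Spectra and property (UW_E) read pointwise -/

theorem zero_lt_index_iff {A : H →L[ℂ] H} : 0 < index A ↔ defect A < nullity A := by
  rw [index, EReal.sub_pos, EReal.coe_ennreal_lt_coe_ennreal_iff, ENat.toENNReal_lt]

theorem mem_pointSpectrum_iff {T : H →L[ℂ] H} {z : ℂ} :
    z ∈ pointSpectrum T ↔ nullity (shift T z) ≠ 0 := by
  rw [Ne, nullity_eq_zero_iff, injective_iff_map_eq_zero]
  constructor
  · intro h hn
    obtain ⟨x, hx, hx0⟩ := h.exists_hasEigenvector
    refine hx0 (hn x ?_)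
    rw [shift_apply, sub_eq_zero]
    exact Module.End.mem_eigenspace_iff.1 hx
  · intro h
    push Not at h
    obtain ⟨x, hx, hx0⟩ := h
    rw [shift_apply, sub_eq_zero] at hx
    exact Module.End.hasEigenvalue_of_hasEigenvector
      ⟨Module.End.mem_eigenspace_iff.2 hx, hx0⟩

theorem mem_spectrum_iff_not_isUnit_shift {T : H →L[ℂ] H} {z : ℂ} :
    z ∈ spectrum ℂ T ↔ ¬ IsUnit (shift T z) := by
  rw [spectrum.mem_iff, ← IsUnit.neg_iff, neg_sub, Algebra.algebraMap_eq_smul_one, shift_eq]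

theorem notMem_derivedSet_spectrum_iff {T : H →L[ℂ] H} {z : ℂ} :
    z ∉ derivedSet (spectrum ℂ T) ↔
      ∀ᶠ w in 𝓝[≠] (0 : ℂ), IsUnit (shift (shift T z) w) := by
  have h : map (z + ·) (𝓝[≠] 0) = 𝓝[≠] z := by
    rw [Filter.map_add_left_nhdsNE, add_zero]
  rw [mem_derivedSet, accPt_iff_frequently_nhdsNE, not_frequently, ← h, eventually_map]
  simp only [mem_spectrum_iff_not_isUnit_shift, not_not, shift_shift]

/-- Only eigenvalues matter: an upper semi-Fredholm shift that is not bounded below has a nonzero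
kernel, so both sets in the property consist of eigenvalues. -/
theorem hasPropertyUWE_iff {T : H →L[ℂ] H} [CompleteSpace H] :
    HasPropertyUWE T ↔ ∀ z, nullity (shift T z) ≠ 0 →
      ((IsUpperSemiFredholm (shift T z) ∧ nullity (shift T z) ≤ defect (shift T z)) ↔
        ∀ᶠ w in 𝓝[≠] (0 : ℂ), IsUnit (shift (shift T z) w)) := by
  rw [HasPropertyUWE, Set.ext_iff]
  refine forall_congr' fun z => ?_
  have hunit : nullity (shift T z) ≠ 0 → ¬ IsUnit (shift T z) := fun h hu =>
    h (nullity_eq_zero_iff.2 (ContinuousLinearMap.isUnit_iff_bijective.1 hu).1)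
  simp only [isolatedEigenvalues, iso, Set.mem_inter_iff, Set.mem_sdiff,
    mem_spectrum_iff_not_isUnit_shift, notMem_derivedSet_spectrum_iff, mem_pointSpectrum_iff,
    approxPointSpectrum, essApproxPointSpectrum, Set.mem_ofPred_eq, IsBoundedBelow,
    zero_lt_index_iff, not_or, not_not, not_lt]
  tauto

/-! ### Adjoints, CI operators and the pointwise equivalence -/

section Complete

variable [CompleteSpace H]

theorem isUpperSemiFredholm_adjoint_iff {A : H →L[ℂ] H} :
    IsUpperSemiFredholm (ContinuousLinearMap.adjoint A) ↔ IsLowerSemiFredholm A := by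
  constructor
  · rintro ⟨h1, h2⟩
    have hr := isClosed_range_adjoint h2
    rw [ContinuousLinearMap.adjoint_adjoint] at hr
    exact (defect_eq_nullity_adjoint hr).trans_lt h1
  · intro h
    exact ⟨(defect_eq_nullity_adjoint h.isClosed_range).symm.trans_lt h,
      isClosed_range_adjoint h.isClosed_range⟩

theorem eventually_isUnit_shift_adjoint_iff {A : H →L[ℂ] H} :
    (∀ᶠ w in 𝓝[≠] (0 : ℂ), IsUnit (shift (ContinuousLinearMap.adjoint A) w)) ↔
      ∀ᶠ w in 𝓝[≠] (0 : ℂ), IsUnit (shift A w) := by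
  have key : ∀ B : H →L[ℂ] H, (∀ᶠ w in 𝓝[≠] (0 : ℂ), IsUnit (shift B w)) →
      ∀ᶠ w in 𝓝[≠] (0 : ℂ), IsUnit (shift (ContinuousLinearMap.adjoint B) w) := by
    intro B hB
    filter_upwards [tendsto_conj_nhdsNE_zero.eventually hB] with w hw
    rwa [← Complex.conj_conj w, shift_adjoint, isUnit_adjoint_iff]
  exact ⟨fun h => by simpa using key _ h, key A⟩

/-- Reindexing by z ↦ z̄ turns shifts of T* into adjoints of shifts of T. The hypothesis keeps the
nullity of the adjoint, since it equals the defect only once the range is known to be closed. -/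
theorem hasPropertyUWE_adjoint_iff {T : H →L[ℂ] H} :
    HasPropertyUWE (ContinuousLinearMap.adjoint T) ↔
      ∀ z, nullity (ContinuousLinearMap.adjoint (shift T z)) ≠ 0 →
        ((IsLowerSemiFredholm (shift T z) ∧ defect (shift T z) ≤ nullity (shift T z)) ↔
          ∀ᶠ w in 𝓝[≠] (0 : ℂ), IsUnit (shift (shift T z) w)) := by
  rw [hasPropertyUWE_iff, ← (Equiv.forall_congr_right (star_involutive (R := ℂ)).toPerm)]
  refine forall_congr' fun z => ?_
  change (nullity (shift _ (conj z)) ≠ 0 → ((IsUpperSemiFredholm (shift _ (conj z)) ∧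
    nullity (shift _ (conj z)) ≤ defect (shift _ (conj z))) ↔
      ∀ᶠ w in 𝓝[≠] (0 : ℂ), IsUnit (shift (shift _ (conj z)) w))) ↔ _
  rw [shift_adjoint, isUpperSemiFredholm_adjoint_iff, eventually_isUnit_shift_adjoint_iff]
  refine imp_congr_right fun _ => iff_congr (and_congr_right fun h => ?_) Iff.rfl
  rw [← defect_eq_nullity_adjoint h.isClosed_range, ← nullity_eq_defect_adjoint h.isClosed_range]

/-- On a Hilbert space, the operators that are not consistent in invertibility are those that are
invertible from exactly one side. -/
theorem not_isCI_iff {A : H →L[ℂ] H} :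
    ¬ IsCI A ↔
      (IsClosed (A.range : Set H) ∧ Function.Injective A ∧ ¬ Function.Surjective A) ∨
        (Function.Surjective A ∧ ¬ Function.Injective A) := by
  have hinj : ∀ S : H →L[ℂ] H, IsUnit (S * A) → Function.Injective A := fun S h =>
    Function.Injective.of_comp (f := S) (ContinuousLinearMap.isUnit_iff_bijective.1 h).1
  have hsurj : ∀ S : H →L[ℂ] H, IsUnit (A * S) → Function.Surjective A := fun S h =>
    Function.Surjective.of_comp (g := S) (ContinuousLinearMap.isUnit_iff_bijective.1 h).2
  have hunit : Function.Injective A → Function.Surjective A → IsCI A := by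
    intro hi hs S
    obtain ⟨u, rfl⟩ := ContinuousLinearMap.isUnit_iff_bijective.2 ⟨hi, hs⟩
    rw [Units.isUnit_mul_units, Units.isUnit_units_mul]
  constructor
  · intro h
    by_cases hi : Function.Injective A
    · refine Or.inl ⟨?_, hi, fun hs => h (hunit hi hs)⟩
      by_contra hr
      refine h fun S => ⟨fun hS => (hr ?_).elim, fun hS => (hr ?_).elim⟩
      -- If SA = u is invertible, u⁻¹S is a left inverse of A, which forces closed range.
      · obtain ⟨u, hu⟩ := hS
        refine isClosed_range_of_mul_mul_eq_self (B := ↑u⁻¹ * S) ?_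
        rw [mul_assoc, mul_assoc, ← hu, Units.inv_mul, mul_one]
      · rw [LinearMap.range_eq_top.2 (hsurj S hS)]
        exact isClosed_univ
    · refine Or.inr ⟨?_, hi⟩
      by_contra hs
      exact h fun S => ⟨fun hS => (hi (hinj S hS)).elim, fun hS => (hs (hsurj S hS)).elim⟩
  · rintro (⟨hr, hi, hs⟩ | ⟨hs, hi⟩) hCI
    · obtain ⟨B, hB⟩ := exists_mul_mul_eq_self hr
      have hBA : B * A = 1 := by
        ext x
        exact hi (DFunLike.congr_fun hB x)
      exact hs (hsurj B ((hCI B).1 (hBA ▸ isUnit_one)))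
    · have hr : IsClosed (A.range : Set H) := by
        rw [LinearMap.range_eq_top.2 hs]; exact isClosed_univ
      obtain ⟨B, hB⟩ := exists_mul_mul_eq_self hr
      have hAB : A * B = 1 := by
        ext y
        obtain ⟨x, rfl⟩ := hs y
        exact DFunLike.congr_fun hB x
      exact hi (hinj B ((hCI B).2 (hAB ▸ isUnit_one)))

theorem IsBrowder.nullity_eq_defect {A : H →L[ℂ] H} (hA : IsBrowder A) : nullity A = defect A :=
  (isBrowder_of_frequently_isUnit_shift (.inl hA.1.1) hA.eventually_isUnit_shift.frequently).2

/-- The pointwise form of the characterization of property `(UW_E)` for an operator and its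
adjoint. -/
theorem propertyUWE_at_iff (A : H →L[ℂ] H) :
    ((nullity A ≠ 0 → ((IsUpperSemiFredholm A ∧ nullity A ≤ defect A) ↔
        ∀ᶠ w in 𝓝[≠] (0 : ℂ), IsUnit (shift A w))) ∧
      (nullity (ContinuousLinearMap.adjoint A) ≠ 0 →
        ((IsLowerSemiFredholm A ∧ defect A ≤ nullity A) ↔
          ∀ᶠ w in 𝓝[≠] (0 : ℂ), IsUnit (shift A w)))) ↔
      (¬ IsBrowder A ↔ (¬ IsCI A ∨
        (¬ IsUnit A ∧ nullity A = 0 ∧ nullity (ContinuousLinearMap.adjoint A) = 0)) ∨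
          (¬ (∀ᶠ w in 𝓝[≠] (0 : ℂ), IsUnit (shift A w)) ∧
            ¬ IsUpperSemiFredholm A ∧ ¬ IsLowerSemiFredholm A)) := by
  set I : Prop := ∀ᶠ w in 𝓝[≠] (0 : ℂ), IsUnit (shift A w) with hI
  have hbI : IsBrowder A → I := IsBrowder.eventually_isUnit_shift
  have hIb : (IsUpperSemiFredholm A ∨ IsLowerSemiFredholm A) → I → IsBrowder A := fun h hi =>
    (isBrowder_of_frequently_isUnit_shift h hi.frequently).1
  have hbeq : IsBrowder A → nullity A = defect A := IsBrowder.nullity_eq_defect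
  have hclosed : (IsUpperSemiFredholm A ∨ IsLowerSemiFredholm A) →
      IsClosed (A.range : Set H) := fun h => h.elim (fun h => h.2) fun h => h.isClosed_range
  have hunit : IsUnit A ↔ nullity A = 0 ∧ defect A = 0 := by
    rw [nullity_eq_zero_iff, defect_eq_zero_iff]
    exact ContinuousLinearMap.isUnit_iff_bijective
  have hCI : ¬ IsCI A ↔ (IsClosed (A.range : Set H) ∧ nullity A = 0 ∧ defect A ≠ 0) ∨
      (defect A = 0 ∧ nullity A ≠ 0) := by
    rw [not_isCI_iff, ← nullity_eq_zero_iff, ← defect_eq_zero_iff]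
  have hIs : I → defect A = 0 → nullity A = 0 := by
    intro h hd
    rw [defect_eq_zero_iff] at hd
    exact nullity_eq_zero_iff.2 (injective_of_frequently_injective_shift hd
      (h.frequently.mono fun w hw => (ContinuousLinearMap.isUnit_iff_bijective.1 hw).1))
  have hIi : I → IsClosed (A.range : Set H) → nullity A = 0 → defect A = 0 := by
    intro h hr hn
    rw [nullity_eq_zero_iff] at hn
    exact defect_eq_zero_iff.2 (surjective_of_frequently_surjective_shift hn hr
      (h.frequently.mono fun w hw => (ContinuousLinearMap.isUnit_iff_bijective.1 hw).2))
  have hadj : IsClosed (A.range : Set H) →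
      defect A = nullity (ContinuousLinearMap.adjoint A) := defect_eq_nullity_adjoint
  have hadj0 : defect A = 0 → nullity (ContinuousLinearMap.adjoint A) = 0 := by
    intro h
    rw [← hadj ?_, h]
    rw [LinearMap.range_eq_top.2 (defect_eq_zero_iff.1 h)]
    exact isClosed_univ
  have hub : IsUnit A → IsBrowder A := by
    intro h
    refine hIb (.inr ?_) (eventually_isUnit_shift_of_isUnit h)
    rw [IsLowerSemiFredholm, (hunit.1 h).2]
    exact ENat.natCast_lt_top 0
  constructor
  · rintro ⟨h1, h2⟩
    constructor
    · intro hb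
      by_contra hcon
      rw [not_or, not_or, hCI] at hcon
      obtain ⟨⟨hci, hpi⟩, hsf⟩ := hcon
      have hu : ¬ IsUnit A := fun h => hb (hub h)
      by_cases hS : IsUpperSemiFredholm A ∨ IsLowerSemiFredholm A
      · have hr := hclosed hS
        have hn : nullity A ≠ 0 := fun h0 => by
          by_cases hd : defect A = 0
          · exact hu (hunit.2 ⟨h0, hd⟩)
          · exact hci (.inl ⟨hr, h0, hd⟩)
        have hd : defect A ≠ 0 := fun h0 => hci (.inr ⟨h0, hn⟩)
        -- The smaller of n(A) and d(A) is finite, so the order between them selects the property,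
        -- of T or of T*, that yields I.
        refine hb (hIb hS ?_)
        rcases le_total (nullity A) (defect A) with hle | hle
        · refine (h1 hn).1 ⟨?_, hle⟩
          exact hS.elim id fun h => ⟨hle.trans_lt h, hr⟩
        · refine (h2 (hadj hr ▸ hd)).1 ⟨?_, hle⟩
          exact hS.elim (fun h => hle.trans_lt h.1) id
      -- Without semi-Fredholmness I must hold, and A or A* has a nonzero kernel; the corresponding
      -- property then makes A semi-Fredholm after all.
      · have hi : I := by_contra fun hi => hsf ⟨hi, fun h => hS (.inl h), fun h => hS (.inr h)⟩
        by_cases hn : nullity A = 0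
        · have hn' : nullity (ContinuousLinearMap.adjoint A) ≠ 0 := fun h0 =>
            hpi ⟨hu, hn, h0⟩
          exact hS (.inr ((h2 hn').2 hi).1)
        · exact hS (.inl ((h1 hn).2 hi).1)
    · rintro ((h | ⟨h, hn, -⟩) | ⟨-, h, -⟩) hb
      · have := hbeq hb
        rw [hCI] at h
        rcases h with ⟨-, h, h'⟩ | ⟨h, h'⟩
        · exact h' (this ▸ h)
        · exact h' (this.trans h)
      · exact h (hunit.2 ⟨hn, hbeq hb ▸ hn⟩)
      · exact h hb.1.1
  · intro h
    -- In this form, A is Browder as soon as it avoids every set on the right. Each case below rules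
    -- these out, and `hbI` or `hbeq` supplies the rest.
    rw [not_iff_comm, hCI] at h
    refine ⟨fun hn => ⟨fun ⟨hS, hle⟩ => hbI (h.1 ?_), fun hi => ?_⟩,
      fun hn => ⟨fun ⟨hS, hle⟩ => hbI (h.1 ?_), fun hi => ?_⟩⟩
    · have hd : defect A ≠ 0 := fun h0 => hn (le_antisymm (h0 ▸ hle) zero_le)
      rintro (((⟨-, h0, -⟩ | ⟨h0, -⟩) | ⟨-, h0, -⟩) | ⟨-, h0, -⟩)
      exacts [hn h0, hd h0, hn h0, h0 hS]
    · have hB : IsBrowder A := h.1 (by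
        rintro (((⟨-, h0, -⟩ | ⟨h0, -⟩) | ⟨-, h0, -⟩) | ⟨h0, -⟩)
        exacts [hn h0, hn (hIs hi h0), hn h0, h0 hi])
      exact ⟨hB.1.1, (hbeq hB).le⟩
    · rw [← hadj hS.isClosed_range] at hn
      have hn' : nullity A ≠ 0 := fun h0 => hn (le_antisymm (h0 ▸ hle) zero_le)
      rintro (((⟨-, h0, -⟩ | ⟨h0, -⟩) | ⟨-, h0, -⟩) | ⟨-, -, h0⟩)
      exacts [hn' h0, hn h0, hn' h0, h0 hS]
    · have hB : IsBrowder A := h.1 (by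
        rintro (((⟨hr, h0, hd⟩ | ⟨h0, -⟩) | ⟨-, -, h0⟩) | ⟨h0, -⟩)
        exacts [hd (hIi hi hr h0), hn (hadj0 h0), hn h0, h0 hi])
      exact ⟨hB.1.2, (hbeq hB).ge⟩

end Complete

end PropertyUWE

theorem theorem3p5 {H : Type*} [NormedAddCommGroup H] [InnerProductSpace ℂ H] [CompleteSpace H]
    [TopologicalSpace.SeparableSpace H] (hH : ¬ FiniteDimensional ℂ H) (T : H →L[ℂ] H) :
    (PropertyUWE.HasPropertyUWE T ∧
        PropertyUWE.HasPropertyUWE (ContinuousLinearMap.adjoint T)) ↔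
      PropertyUWE.browderSpectrum T =
        PropertyUWE.ciSpectrum T ∪ PropertyUWE.piStar T ∪
          (derivedSet (spectrum ℂ T) ∩ PropertyUWE.semiFredholmSpectrum T) := by
  rw [PropertyUWE.hasPropertyUWE_iff, PropertyUWE.hasPropertyUWE_adjoint_iff, ← forall_and,
    Set.ext_iff]
  refine forall_congr' fun z => ?_
  rw [PropertyUWE.propertyUWE_at_iff, ← PropertyUWE.notMem_derivedSet_spectrum_iff, not_not,
    ← PropertyUWE.mem_spectrum_iff_not_isUnit_shift, ← PropertyUWE.shift_adjoint]
  rfl
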